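/- Let $N\in\mathbb{N}$, $1<p<\infty$ and $s\in(0,1)$ be such that $sp<N$, and put $p^*_s=\frac{Np}{N-sp}$ and $J_p(t)=|t|^{p-2}t$. For an open set $\Omega\subset\mathbb{R}^N$ let \[ D^{s,p}_0(\Omega)=\Big\{u\in L^{p^*_s}(\mathbb{R}^N):\ \int_{\mathbb{R}^{2N}}\frac{|u(x)-u(y)|^p}{|x-y|^{N+sp}}\,dx\,dy<\infty,\ u=0 \text{ a.e. in }\mathbb{R}^N\setminus\Omega\Big\}. \] Let $\Omega\subset\mathbb{R}^N$ be open, bounded and connected, let $a\in L^{N/(sp)}(\Omega)$, $\mu\in\mathbb{R}$ and $p\le q\le p^*_s$. Let $u\in D^{s,p}_0(\Omega)\setminus\{0\}$ be a nonnegative weak solution of \[ (-\Delta)^s_p u+a\,u^{p-1}\ge \mu\,u^{q-1}\ \text{ in }\Omega,\qquad u=0\ \text{ in }\mathbb{R}^N\setminus\Omega, \] that is, for every $\varphi\in D^{s,p}_0(\Omega)$ with $\varphi\ge 0$, \[ \int_{\mathbb{R}^{2N}}\frac{J_p(u(x)-u(y))\,(\varphi(x)-\varphi(y))}{|x-y|^{N+sp}}\,dx\,dy+\int_\Omega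 a\,u^{p-1}\varphi\,dx\ \ge\ \mu\int_\Omega u^{q-1}\varphi\,dx . \] Then $u>0$ almost everywhere in $\Omega$. -/

import Mathlib

open MeasureTheory

noncomputable section

/-- The Euclidean space of dimension `N`. -/
abbrev Euc (N : ℕ) : Type := EuclideanSpace ℝ (Fin N)

/-- The monotone function `J_p(t) = |t|^(p-2) t` on the real line (with value `0` at `t = 0`). -/
def Jp (p : ℝ) (t : ℝ) : ℝ := |t| ^ (p - 2) * t

/-- The critical fractional Sobolev exponent `p*_s = N p / (N - s p)`. -/
def critExp (N : ℕ) (s p : ℝ) : ℝ := (N : ℝ) * p / ((N : ℝ) - s * p)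

/-- The `p`-th power of the Gagliardo seminorm of `u`, as an extended nonnegative number:
`∫∫ |u(x) - u(y)|^p / |x - y|^(N + s p) dx dy`. -/
def gagliardoPow (N : ℕ) (s p : ℝ) (u : Euc N → ℝ) : ENNReal :=
  ∫⁻ z : Euc N × Euc N,
    ENNReal.ofReal (|u z.1 - u z.2| ^ p / ‖z.1 - z.2‖ ^ ((N : ℝ) + s * p))

/-- Membership of (the almost everywhere class of) `u` in the space `D^{s,p}_0(Ω)`: `u` belongs to
`L^{p*_s}` of the whole space, its Gagliardo seminorm over the whole space is finite, and `u = 0`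
almost everywhere outside `Ω`. -/
structure MemD0 {N : ℕ} (s p : ℝ) (Ω : Set (Euc N)) (u : Euc N → ℝ) : Prop where
  memLp : MemLp u (ENNReal.ofReal (critExp N s p)) volume
  gagliardo_lt_top : gagliardoPow N s p u < ⊤
  ae_eq_zero : ∀ᵐ x ∂(volume : Measure (Euc N)), x ∉ Ω → u x = 0

/-- The weak form of the fractional `p`-Laplacian:
`∫∫ J_p(u(x) - u(y)) (φ(x) - φ(y)) / |x - y|^(N + s p) dx dy`. -/
def fracPLapForm (N : ℕ) (s p : ℝ) (u φ : Euc N → ℝ) : ℝ :=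
  ∫ z : Euc N × Euc N,
    Jp p (u z.1 - u z.2) * (φ z.1 - φ z.2) / ‖z.1 - z.2‖ ^ ((N : ℝ) + s * p)

/-- A nonnegative function `u` is a weak solution of
`(-Δ)_p^s u + a u^(p-1) ≥ μ u^(q-1)` in `Ω`, `u = 0` outside `Ω`: it is a nonnegative element of
`D^{s,p}_0(Ω)` and the inequality holds when tested with every nonnegative `φ ∈ D^{s,p}_0(Ω)`. -/
structure IsNonnegWeakSupersolution {N : ℕ} (s p q μ : ℝ) (Ω : Set (Euc N)) (a u : Euc N → ℝ) :
    Prop where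
  memD0 : MemD0 s p Ω u
  nonneg : ∀ᵐ x ∂(volume : Measure (Euc N)), 0 ≤ u x
  ineq : ∀ φ : Euc N → ℝ, MemD0 s p Ω φ → (∀ᵐ x ∂(volume : Measure (Euc N)), 0 ≤ φ x) →
    μ * ∫ x in Ω, u x ^ (q - 1) * φ x ≤
      fracPLapForm N s p u φ + ∫ x in Ω, a x * u x ^ (p - 1) * φ x

end

/-! Let η be a cutoff that is positive on Ω and zero outside, and test the inequality with `φ = η^p
(u + δ)^(1 - p)`. By the discrete Picone inequality (`discrete_picone`), `J_p(u(x) - u(y)) (φ(x) -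
φ(y)) ≤ |η(x) - η(y)|^p`, so the difference of the two sides, divided by the kernel, is a
nonnegative defect. The supersolution inequality bounds its integral independently of δ
(`exists_lintegral_piconeDefect_le`), because `u^(q-1) φ ≤ 1 + u^(p*_s)` and `u^(p-1) φ ≤ 1`.

As δ → 0 the defect blows up like `δ^(1-p)` at every pair with u(x) = 0, η(x) > 0 and u(y) > 0. By
Fatou such pairs form a null set. That set is the product of {u = 0, η > 0} and {u > 0}, so one
factor is null; the second is not, as u is nontrivial. -/

/-! ### Discrete Picone inequality. -/

theorem discrete_picone_of_lt {p A B a b : ℝ} (hp : 1 < p) (hB : 0 < B) (hAB : B < A)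
    (ha : 0 ≤ a) (hb : 0 ≤ b) :
    Jp p (A - B) * (a ^ p * A ^ (1 - p) - b ^ p * B ^ (1 - p)) ≤ |a - b| ^ p := by
  have hA : 0 < A := hB.trans hAB
  have hD : 0 < A - B := sub_pos.2 hAB
  have hc := abs_nonneg (a - b)
  -- With weights `B / A` and `(A - B) / A`, these two points average to `b + |a - b| ≥ a`;
  -- convexity of `t^p` then bounds `a^p`.
  have hx : b * (A / B) ∈ Set.Ici (0 : ℝ) := Set.mem_Ici.2 (by positivity)
  have hy : |a - b| * (A / (A - B)) ∈ Set.Ici (0 : ℝ) := Set.mem_Ici.2 (by positivity)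
  have h := (convexOn_rpow hp.le).2 hx hy (by positivity : 0 ≤ B / A)
    (by positivity : 0 ≤ (A - B) / A) (by field_simp; ring)
  simp only [smul_eq_mul] at h
  have e1 : B / A * (b * (A / B)) + (A - B) / A * (|a - b| * (A / (A - B))) = b + |a - b| := by
    field_simp
  have h1 : a ^ p ≤ (b + |a - b|) ^ p := by
    refine Real.rpow_le_rpow ha ?_ (by linarith)
    linarith [le_abs_self (a - b)]
  rw [e1, Real.mul_rpow hb (by positivity), Real.mul_rpow hc (by positivity),
    Real.div_rpow hA.le hB.le, Real.div_rpow hA.le hD.le] at h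
  have h2 := h1.trans h
  have hJ : Jp p (A - B) = (A - B) ^ p / (A - B) := by
    unfold Jp
    rw [abs_of_pos hD, Real.rpow_sub hD, Real.rpow_two]
    field_simp
  rw [hJ, Real.rpow_sub hA, Real.rpow_sub hB, Real.rpow_one, Real.rpow_one]
  have hAp : 0 < A ^ p := Real.rpow_pos_of_pos hA p
  have hBp : 0 < B ^ p := Real.rpow_pos_of_pos hB p
  have hDp : 0 < (A - B) ^ p := Real.rpow_pos_of_pos hD p
  -- The multiplier is `((A - B) / A)^(p - 1)`, which turns the coefficient of `|a - b|^p` into 1.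
  have h3 := mul_le_mul_of_nonneg_left h2
    (show 0 ≤ (A - B) ^ p / (A - B) * (A / A ^ p) by positivity)
  generalize A - B = D at *
  have e2 : D ^ p / D * (A / A ^ p) * (B / A * (b ^ p * (A ^ p / B ^ p)) +
      D / A * (|a - b| ^ p * (A ^ p / D ^ p))) =
      D ^ p / D * (b ^ p * (B / B ^ p)) + |a - b| ^ p := by
    field_simp
  rw [e2] at h3
  linarith

/-- The discrete Picone inequality. -/
theorem discrete_picone {p A B a b : ℝ} (hp : 1 < p) (hA : 0 < A) (hB : 0 < B)
    (ha : 0 ≤ a) (hb : 0 ≤ b) :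
    Jp p (A - B) * (a ^ p * A ^ (1 - p) - b ^ p * B ^ (1 - p)) ≤ |a - b| ^ p := by
  rcases lt_trichotomy A B with h | rfl | h
  · have := discrete_picone_of_lt hp hA h hb ha
    rw [abs_sub_comm b a] at this
    refine le_trans (le_of_eq ?_) this
    unfold Jp
    rw [abs_sub_comm B A]
    ring
  · simp only [Jp, sub_self, mul_zero, zero_mul]
    positivity
  · exact discrete_picone_of_lt hp hB h ha hb

/-! ### Pointwise estimates. -/

theorem abs_Jp_mul_le {p : ℝ} (hp : 1 < p) (t r : ℝ) : |Jp p t * r| ≤ |t| ^ p + |r| ^ p := by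
  have hp0 : 0 < p := by linarith
  rcases eq_or_ne t 0 with rfl | ht
  · simp only [Jp, mul_zero, zero_mul, abs_zero]
    positivity
  have ht' : 0 < |t| := abs_pos.2 ht
  have e : |Jp p t * r| = |t| ^ (p - 1) * |r| := by
    unfold Jp
    rw [abs_mul, abs_mul, abs_of_nonneg (by positivity : 0 ≤ |t| ^ (p - 2)),
      show p - 1 = (p - 2) + 1 by ring, Real.rpow_add ht', Real.rpow_one]
  have key : ∀ m : ℝ, 0 ≤ m → m ^ (p - 1) * m = m ^ p := by
    intro m hm
    rcases hm.eq_or_lt with rfl | hm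
    · rw [mul_zero, Real.zero_rpow hp0.ne']
    · nth_rewrite 2 [← Real.rpow_one m]
      rw [← Real.rpow_add hm]
      ring_nf
  rw [e]
  have ht0 : 0 ≤ |t| ^ p := by positivity
  have hr0 : 0 ≤ |r| ^ p := by positivity
  rcases le_total |t| |r| with h | h
  · calc |t| ^ (p - 1) * |r| ≤ |r| ^ (p - 1) * |r| := by
          gcongr
      _ = |r| ^ p := key _ (abs_nonneg r)
      _ ≤ _ := by linarith
  · calc |t| ^ (p - 1) * |r| ≤ |t| ^ (p - 1) * |t| := by gcongr
      _ = |t| ^ p := key _ (abs_nonneg t)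
      _ ≤ _ := by linarith

theorem measurable_Jp (p : ℝ) : Measurable (Jp p) := by
  unfold Jp
  fun_prop

theorem abs_rpow_sub_rpow_le {p a b : ℝ} (hp : 1 ≤ p) (ha : a ∈ Set.Icc (0 : ℝ) 1)
    (hb : b ∈ Set.Icc (0 : ℝ) 1) : |a ^ p - b ^ p| ≤ p * |a - b| := by
  have := Convex.norm_image_sub_le_of_norm_deriv_le (f := fun x : ℝ => x ^ p) (C := p)
    (s := Set.Icc 0 1) (x := b) (y := a)
    (fun x _ => (Real.hasDerivAt_rpow_const (Or.inr hp)).differentiableAt)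
    (fun x hx => by
      rw [(Real.hasDerivAt_rpow_const (Or.inr hp)).deriv, norm_mul, Real.norm_eq_abs,
        Real.norm_eq_abs, abs_of_nonneg (by linarith : 0 ≤ p),
        abs_of_nonneg (Real.rpow_nonneg hx.1 _)]
      exact mul_le_of_le_one_right (by linarith)
        (Real.rpow_le_one hx.1 hx.2 (by linarith))) (convex_Icc 0 1) hb ha
  simpa [Real.norm_eq_abs] using this

theorem abs_rpow_one_sub_sub_le {p δ a b : ℝ} (hp : 1 < p) (hδ : 0 < δ) (ha : δ ≤ a)
    (hb : δ ≤ b) : |a ^ (1 - p) - b ^ (1 - p)| ≤ (p - 1) * δ ^ (-p) * |a - b| := by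
  have := Convex.norm_image_sub_le_of_norm_deriv_le (f := fun x : ℝ => x ^ (1 - p))
    (C := (p - 1) * δ ^ (-p)) (s := Set.Ici δ) (x := b) (y := a)
    (fun x hx => (Real.hasDerivAt_rpow_const
      (Or.inl (hδ.trans_le hx).ne')).differentiableAt)
    (fun x hx => by
      rw [(Real.hasDerivAt_rpow_const (Or.inl (hδ.trans_le hx).ne')).deriv, norm_mul,
        Real.norm_eq_abs, Real.norm_eq_abs, abs_of_neg (by linarith : 1 - p < 0),
        abs_of_nonneg (Real.rpow_nonneg (hδ.le.trans hx) _), neg_sub,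
        show 1 - p - 1 = -p by ring]
      exact mul_le_mul_of_nonneg_left (Real.rpow_le_rpow_of_nonpos hδ hx (by linarith))
        (by linarith)) (convex_Ici δ) hb ha
  simpa [Real.norm_eq_abs] using this

/-- Mean value bounds on each factor of the test function. The constants degenerate as δ → 0, which
is harmless: they only serve to show that each test function is admissible. -/
theorem abs_test_sub_le {p δ a b A B : ℝ} (hp : 1 < p) (hδ : 0 < δ)
    (ha : a ∈ Set.Icc (0 : ℝ) 1) (hb : b ∈ Set.Icc (0 : ℝ) 1) (hA : δ ≤ A) (hB : δ ≤ B) :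
    |a ^ p * A ^ (1 - p) - b ^ p * B ^ (1 - p)| ≤
      (p * δ ^ (1 - p)) * |a - b| + ((p - 1) * δ ^ (-p)) * |A - B| := by
  have hA0 := hδ.trans_le hA
  have e : a ^ p * A ^ (1 - p) - b ^ p * B ^ (1 - p) =
      (a ^ p - b ^ p) * A ^ (1 - p) + b ^ p * (A ^ (1 - p) - B ^ (1 - p)) := by ring
  have h1 := abs_rpow_sub_rpow_le hp.le ha hb
  have h2 := abs_rpow_one_sub_sub_le hp hδ hA hB
  have h3 : A ^ (1 - p) ≤ δ ^ (1 - p) := Real.rpow_le_rpow_of_nonpos hδ hA (by linarith)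
  have h4 : b ^ p ≤ 1 := Real.rpow_le_one hb.1 hb.2 (by linarith)
  have h5 : 0 ≤ b ^ p := Real.rpow_nonneg hb.1 p
  have h6 : 0 ≤ A ^ (1 - p) := Real.rpow_nonneg hA0.le _
  rw [e]
  refine (abs_add_le _ _).trans ?_
  rw [abs_mul, abs_mul, abs_of_nonneg h5, abs_of_nonneg h6]
  refine add_le_add ?_ ?_
  · calc |a ^ p - b ^ p| * A ^ (1 - p) ≤ (p * |a - b|) * δ ^ (1 - p) := by
          gcongr
      _ = _ := by ring
  · exact (mul_le_of_le_one_left (abs_nonneg _) h4).trans h2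

theorem add_rpow_le_two_rpow_mul {p x y : ℝ} (hp : 0 ≤ p) (hx : 0 ≤ x) (hy : 0 ≤ y) :
    (x + y) ^ p ≤ 2 ^ p * (x ^ p + y ^ p) := by
  have h1 : (x + y) ^ p ≤ (2 * max x y) ^ p := by
    refine Real.rpow_le_rpow (by positivity) ?_ hp
    linarith [le_max_left x y, le_max_right x y]
  rw [Real.mul_rpow (by norm_num) (le_max_of_le_left hx)] at h1
  refine h1.trans (mul_le_mul_of_nonneg_left ?_ (by positivity))
  have hx' : 0 ≤ x ^ p := by positivity
  have hy' : 0 ≤ y ^ p := by positivity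
  rcases max_choice x y with h | h <;> rw [h] <;> linarith

/-! ### Gagliardo energies and integrability. -/

/-- In polar coordinates the radial integrand is `r^(p - s p - 1)` near 0, integrable as s < 1, and
`r^(-1 - s p)` at infinity, integrable as s p > 0. -/
theorem integrable_min_norm_rpow_div {N : ℕ} {s p : ℝ} (hs0 : 0 < s) (hs1 : s < 1) (hp : 0 < p)
    (hN : 0 < N) :
    Integrable (fun h : Euc N => min ‖h‖ 1 ^ p / ‖h‖ ^ ((N : ℝ) + s * p)) := by
  have : Nonempty (Fin N) := ⟨⟨0, hN⟩⟩
  have hsp : 0 < s * p := mul_pos hs0 hp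
  have hsp' : s * p < p := by nlinarith
  refine (integrable_fun_norm_addHaar volume
    (f := fun r : ℝ => min r 1 ^ p / r ^ ((N : ℝ) + s * p))).2 ?_
  rw [finrank_euclideanSpace, Fintype.card_fin, ← Set.Ioo_union_Ici_eq_Ioi zero_lt_one]
  have hpow : ∀ r : ℝ, 0 < r → r ^ (N - 1) = r ^ ((N : ℝ) - 1) := by
    intro r _
    rw [← Real.rpow_natCast, Nat.cast_sub hN, Nat.cast_one]
  refine IntegrableOn.union ?_ ?_
  · have := (intervalIntegral.integrableOn_Ioo_rpow_iff (s := p - s * p - 1) zero_lt_one).2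
      (by linarith)
    refine this.congr_fun (fun r hr => ?_) measurableSet_Ioo
    simp only [smul_eq_mul]
    rw [min_eq_left hr.2.le, hpow r hr.1, ← Real.rpow_sub hr.1, ← Real.rpow_add hr.1]
    congr 1
    ring
  · rw [integrableOn_Ici_iff_integrableOn_Ioi]
    have := integrableOn_Ioi_rpow_of_lt (a := -1 - s * p) (by linarith) zero_lt_one
    refine this.congr_fun (fun r hr => ?_) measurableSet_Ioi
    have hr0 : 0 < r := zero_lt_one.trans hr
    simp only [smul_eq_mul]
    rw [min_eq_right (le_of_lt hr), hpow r hr0, Real.one_rpow, one_div, ← Real.rpow_neg hr0.le,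
      ← Real.rpow_add hr0]
    congr 1
    ring

theorem lintegral_indicator_fst_mul_sub {N : ℕ} {S : Set (Euc N)} (hS : MeasurableSet S)
    {g : Euc N → ENNReal} (hg : Measurable g) :
    ∫⁻ z : Euc N × Euc N, S.indicator 1 z.1 * g (z.1 - z.2) = volume S * ∫⁻ h, g h := by
  have h1 : Measurable (S.indicator (1 : Euc N → ENNReal)) := measurable_one.indicator hS
  rw [Measure.volume_eq_prod, lintegral_prod _ (by fun_prop)]
  have : ∀ x : Euc N, ∫⁻ y : Euc N, S.indicator 1 x * g (x - y) =
      S.indicator 1 x * ∫⁻ h, g h := by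
    intro x
    rw [lintegral_const_mul _ (by fun_prop), lintegral_sub_left_eq_self]
  simp_rw [this]
  rw [lintegral_mul_const _ h1, lintegral_indicator_one hS]

theorem lintegral_indicator_snd_mul_sub {N : ℕ} {S : Set (Euc N)} (hS : MeasurableSet S)
    {g : Euc N → ENNReal} (hg : Measurable g) :
    ∫⁻ z : Euc N × Euc N, S.indicator 1 z.2 * g (z.1 - z.2) = volume S * ∫⁻ h, g h := by
  have h1 : Measurable (S.indicator (1 : Euc N → ENNReal)) := measurable_one.indicator hS
  rw [Measure.volume_eq_prod, lintegral_prod_symm' _ (by fun_prop)]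
  have : ∀ y : Euc N, ∫⁻ x : Euc N, S.indicator 1 y * g (x - y) =
      S.indicator 1 y * ∫⁻ h, g h := by
    intro y
    rw [lintegral_const_mul _ (by fun_prop), lintegral_sub_right_eq_self]
  simp_rw [this]
  rw [lintegral_mul_const _ h1, lintegral_indicator_one hS]

/-- The integrand vanishes unless one of the two points lies in `S`; fixing that point leaves an
integrable function of the difference. -/
theorem gagliardoPow_lt_top_of_lipschitz {N : ℕ} {s p : ℝ} (hs0 : 0 < s) (hs1 : s < 1)
    (hp : 0 < p) (hN : 0 < N) {S : Set (Euc N)} (hS : MeasurableSet S) (hSv : volume S < ⊤)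
    {f : Euc N → ℝ} (hf1 : ∀ x y, |f x - f y| ≤ ‖x - y‖) (hf2 : ∀ x y, |f x - f y| ≤ 1)
    (hf0 : ∀ x, x ∉ S → f x = 0) : gagliardoPow N s p f < ⊤ := by
  set g : Euc N → ENNReal :=
    fun h => ENNReal.ofReal (min ‖h‖ 1 ^ p / ‖h‖ ^ ((N : ℝ) + s * p)) with hgdef
  have hg : Measurable g := by fun_prop
  have hgi : ∫⁻ h, g h < ⊤ := (integrable_min_norm_rpow_div hs0 hs1 hp hN).lintegral_lt_top
  have h1 : Measurable (S.indicator (1 : Euc N → ENNReal)) := measurable_one.indicator hS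
  have key : ∀ z : Euc N × Euc N,
      ENNReal.ofReal (|f z.1 - f z.2| ^ p / ‖z.1 - z.2‖ ^ ((N : ℝ) + s * p)) ≤
        S.indicator 1 z.1 * g (z.1 - z.2) + S.indicator 1 z.2 * g (z.1 - z.2) := by
    intro z
    have hle : ENNReal.ofReal (|f z.1 - f z.2| ^ p / ‖z.1 - z.2‖ ^ ((N : ℝ) + s * p)) ≤
        g (z.1 - z.2) := by
      refine ENNReal.ofReal_le_ofReal ?_
      gcongr
      exact le_min (hf1 _ _) (hf2 _ _)
    by_cases hz1 : z.1 ∈ S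
    · refine le_add_right ?_
      simpa [hz1] using hle
    by_cases hz2 : z.2 ∈ S
    · refine le_add_left ?_
      simpa [hz2] using hle
    · simp [hf0 _ hz1, hf0 _ hz2, Real.zero_rpow hp.ne']
  refine (lintegral_mono key).trans_lt ?_
  rw [lintegral_add_left (by fun_prop), lintegral_indicator_fst_mul_sub hS hg,
    lintegral_indicator_snd_mul_sub hS hg]
  exact ENNReal.add_lt_top.2 ⟨ENNReal.mul_lt_top hSv hgi, ENNReal.mul_lt_top hSv hgi⟩

theorem aemeasurable_gagliardo_quotient {N : ℕ} {s p : ℝ} {f : Euc N → ℝ}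
    (hf : AEMeasurable f) :
    AEMeasurable (fun z : Euc N × Euc N =>
      |f z.1 - f z.2| ^ p / ‖z.1 - z.2‖ ^ ((N : ℝ) + s * p)) := by
  have h1 : AEMeasurable (fun z : Euc N × Euc N => f z.1) :=
    hf.comp_quasiMeasurePreserving Measure.quasiMeasurePreserving_fst
  have h2 : AEMeasurable (fun z : Euc N × Euc N => f z.2) :=
    hf.comp_quasiMeasurePreserving Measure.quasiMeasurePreserving_snd
  have h3 : Measurable (fun z : Euc N × Euc N => ‖z.1 - z.2‖ ^ ((N : ℝ) + s * p)) := by fun_prop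
  exact ((h1.sub h2).abs.pow_const p).div h3.aemeasurable

theorem integrable_gagliardo_quotient {N : ℕ} {s p : ℝ} {f : Euc N → ℝ}
    (hf : AEMeasurable f) (h : gagliardoPow N s p f < ⊤) :
    Integrable (fun z : Euc N × Euc N =>
      |f z.1 - f z.2| ^ p / ‖z.1 - z.2‖ ^ ((N : ℝ) + s * p)) := by
  refine ⟨(aemeasurable_gagliardo_quotient hf).aestronglyMeasurable, ?_⟩
  rw [hasFiniteIntegral_iff_ofReal (Filter.Eventually.of_forall fun z => by positivity)]
  exact h

theorem ae_fst_and_snd {N : ℕ} {P : Euc N → Prop} (h : ∀ᵐ x : Euc N, P x) :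
    ∀ᵐ z : Euc N × Euc N, P z.1 ∧ P z.2 :=
  (Measure.quasiMeasurePreserving_fst.ae h).and (Measure.quasiMeasurePreserving_snd.ae h)

theorem gagliardoPow_lt_top_of_abs_sub_le {N : ℕ} {s p : ℝ} (hp : 0 ≤ p) {f g h : Euc N → ℝ}
    (hf : AEMeasurable f) (hg : AEMeasurable g) (hf' : gagliardoPow N s p f < ⊤)
    (hg' : gagliardoPow N s p g < ⊤) {C D : ℝ} (hC : 0 ≤ C) (hD : 0 ≤ D)
    (hle : ∀ᵐ z : Euc N × Euc N,
      |h z.1 - h z.2| ≤ C * |f z.1 - f z.2| + D * |g z.1 - g z.2|) :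
    gagliardoPow N s p h < ⊤ := by
  have hi := ((integrable_gagliardo_quotient hf hf').const_mul (2 ^ p * C ^ p)).add
    ((integrable_gagliardo_quotient hg hg').const_mul (2 ^ p * D ^ p))
  refine lt_of_le_of_lt (lintegral_mono_ae ?_) hi.lintegral_lt_top
  filter_upwards [hle] with z hz
  refine ENNReal.ofReal_le_ofReal ?_
  simp only [Pi.add_apply]
  rw [mul_div_assoc', mul_div_assoc', ← add_div]
  gcongr
  calc |h z.1 - h z.2| ^ p ≤ (C * |f z.1 - f z.2| + D * |g z.1 - g z.2|) ^ p := by gcongr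
    _ ≤ 2 ^ p * ((C * |f z.1 - f z.2|) ^ p + (D * |g z.1 - g z.2|) ^ p) :=
      add_rpow_le_two_rpow_mul hp (by positivity) (by positivity)
    _ = _ := by
      rw [Real.mul_rpow hC (abs_nonneg _), Real.mul_rpow hD (abs_nonneg _)]
      ring

theorem integrable_fracPLap_integrand {N : ℕ} {s p : ℝ} (hp : 1 < p) {u φ : Euc N → ℝ}
    (hu : AEMeasurable u) (hφ : AEMeasurable φ) (hu' : gagliardoPow N s p u < ⊤)
    (hφ' : gagliardoPow N s p φ < ⊤) :
    Integrable (fun z : Euc N × Euc N =>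
      Jp p (u z.1 - u z.2) * (φ z.1 - φ z.2) / ‖z.1 - z.2‖ ^ ((N : ℝ) + s * p)) := by
  refine ((integrable_gagliardo_quotient hu hu').add
    (integrable_gagliardo_quotient hφ hφ')).mono' ?_ (Filter.Eventually.of_forall fun z => ?_)
  · have h1 : AEMeasurable (fun z : Euc N × Euc N => u z.1 - u z.2) :=
      (hu.comp_quasiMeasurePreserving Measure.quasiMeasurePreserving_fst).sub
        (hu.comp_quasiMeasurePreserving Measure.quasiMeasurePreserving_snd)
    have h2 : AEMeasurable (fun z : Euc N × Euc N => φ z.1 - φ z.2) :=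
      (hφ.comp_quasiMeasurePreserving Measure.quasiMeasurePreserving_fst).sub
        (hφ.comp_quasiMeasurePreserving Measure.quasiMeasurePreserving_snd)
    have h3 : Measurable (fun z : Euc N × Euc N => ‖z.1 - z.2‖ ^ ((N : ℝ) + s * p)) := by
      fun_prop
    exact ((((measurable_Jp p).comp_aemeasurable h1).mul h2).div
      h3.aemeasurable).aestronglyMeasurable
  · simp only [Pi.add_apply]
    rw [← add_div, Real.norm_eq_abs, abs_div,
      abs_of_nonneg (by positivity : 0 ≤ ‖z.1 - z.2‖ ^ ((N : ℝ) + s * p))]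
    gcongr
    exact abs_Jp_mul_le hp _ _

/-! ### Test function: δ-uniform bounds and admissibility. -/

/-- The test function `η^p (u + δ)^(1 - p)`. -/
noncomputable def piconeTest {N : ℕ} (p δ : ℝ) (η u : Euc N → ℝ) (x : Euc N) : ℝ :=
  η x ^ p * (u x + δ) ^ (1 - p)

theorem piconeTest_nonneg {N : ℕ} {p δ : ℝ} (hδ : 0 < δ) {η u : Euc N → ℝ} {x : Euc N}
    (hη : 0 ≤ η x) (hu : 0 ≤ u x) : 0 ≤ piconeTest p δ η u x := by
  unfold piconeTest
  positivity

theorem piconeTest_le {N : ℕ} {p δ : ℝ} (hp : 1 < p) (hδ : 0 < δ) {η u : Euc N → ℝ} {x : Euc N}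
    (hη : η x ∈ Set.Icc (0 : ℝ) 1) (hu : 0 ≤ u x) :
    piconeTest p δ η u x ≤ (u x + δ) ^ (1 - p) :=
  mul_le_of_le_one_left (by positivity) (Real.rpow_le_one hη.1 hη.2 (by linarith))

theorem rpow_mul_piconeTest_le {N : ℕ} {p q r δ : ℝ} (hp : 1 < p) (hpq : p ≤ q) (hqr : q ≤ r)
    (hδ : 0 < δ) {η u : Euc N → ℝ} {x : Euc N} (hη : η x ∈ Set.Icc (0 : ℝ) 1) (hu : 0 ≤ u x) :
    u x ^ (q - 1) * piconeTest p δ η u x ≤ 1 + u x ^ r := by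
  rcases hu.eq_or_lt with h | h
  -- Treated apart because `0 ^ (1 - p)` is `0` in Lean, so it does not dominate `(u + δ)^(1 - p)`
  -- here.
  · rw [← h, Real.zero_rpow (by linarith), zero_mul]
    positivity
  · have h1 : piconeTest p δ η u x ≤ u x ^ (1 - p) :=
      (piconeTest_le hp hδ hη hu).trans
        (Real.rpow_le_rpow_of_nonpos h (by linarith) (by linarith))
    calc u x ^ (q - 1) * piconeTest p δ η u x ≤ u x ^ (q - 1) * u x ^ (1 - p) := by gcongr
      _ = u x ^ (q - p) := by
        rw [← Real.rpow_add h]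
        ring_nf
      _ ≤ 1 + u x ^ r := by
        have hr : 0 ≤ u x ^ r := by positivity
        rcases le_total (u x) 1 with h' | h'
        · linarith [Real.rpow_le_one hu h' (by linarith : 0 ≤ q - p)]
        · linarith [Real.rpow_le_rpow_of_exponent_le h' (by linarith : q - p ≤ r)]

theorem rpow_sub_one_mul_piconeTest_le_one {N : ℕ} {p δ : ℝ} (hp : 1 < p)
    (hδ : 0 < δ) {η u : Euc N → ℝ} {x : Euc N} (hη : η x ∈ Set.Icc (0 : ℝ) 1) (hu : 0 ≤ u x) :
    u x ^ (p - 1) * piconeTest p δ η u x ≤ 1 := by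
  have hpos : 0 < u x + δ := by linarith
  calc u x ^ (p - 1) * piconeTest p δ η u x
      ≤ (u x + δ) ^ (p - 1) * (u x + δ) ^ (1 - p) := by
        have h1 := piconeTest_le hp hδ hη hu
        have h2 := piconeTest_nonneg (p := p) hδ hη.1 hu
        have h3 : u x ^ (p - 1) ≤ (u x + δ) ^ (p - 1) :=
          Real.rpow_le_rpow hu (by linarith) (by linarith)
        gcongr
    _ = 1 := by rw [← Real.rpow_add hpos]; simp

theorem aemeasurable_piconeTest {N : ℕ} {p δ : ℝ} {η u : Euc N → ℝ} (hη : Measurable η)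
    (hu : AEMeasurable u) : AEMeasurable (piconeTest p δ η u) := by
  unfold piconeTest
  exact (hη.aemeasurable.pow_const p).mul ((hu.add_const δ).pow_const (1 - p))

theorem memD0_piconeTest {N : ℕ} {s p δ : ℝ} (hp : 1 < p) (hδ : 0 < δ) {Ω : Set (Euc N)}
    (hΩ : MeasurableSet Ω) (hΩv : volume Ω < ⊤) {η u : Euc N → ℝ} (hη : Measurable η)
    (hη1 : ∀ x, η x ∈ Set.Icc (0 : ℝ) 1) (hη0 : ∀ x, x ∉ Ω → η x = 0)
    (hηg : gagliardoPow N s p η < ⊤) (hu : MemD0 s p Ω u) (hu0 : ∀ᵐ x : Euc N, 0 ≤ u x) :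
    MemD0 s p Ω (piconeTest p δ η u) := by
  have hum : AEMeasurable u := hu.memLp.aestronglyMeasurable.aemeasurable
  have hφ0 : ∀ x, x ∉ Ω → piconeTest p δ η u x = 0 := by
    intro x hx
    rw [piconeTest, hη0 x hx, Real.zero_rpow (by linarith), zero_mul]
  refine ⟨?_, ?_, Filter.Eventually.of_forall hφ0⟩
  · have hind : Ω.indicator (piconeTest p δ η u) = piconeTest p δ η u :=
      Set.indicator_eq_self.2 fun x hx => by
        by_contra h
        exact hx (hφ0 x h)
    rw [← hind, memLp_indicator_iff_restrict hΩ]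
    have : IsFiniteMeasure (volume.restrict Ω) := isFiniteMeasure_restrict.2 hΩv.ne
    refine MemLp.of_bound (aemeasurable_piconeTest hη hum).restrict.aestronglyMeasurable
      (δ ^ (1 - p)) (ae_restrict_of_ae ?_)
    filter_upwards [hu0] with x hx
    rw [Real.norm_eq_abs, abs_of_nonneg (piconeTest_nonneg hδ (hη1 x).1 hx)]
    exact (piconeTest_le hp hδ (hη1 x) hx).trans
      (Real.rpow_le_rpow_of_nonpos hδ (by linarith) (by linarith))
  · refine gagliardoPow_lt_top_of_abs_sub_le (by linarith) hη.aemeasurable hum hηg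
      hu.gagliardo_lt_top (C := p * δ ^ (1 - p)) (D := (p - 1) * δ ^ (-p)) (by positivity)
      (mul_nonneg (by linarith) (by positivity)) ?_
    filter_upwards [ae_fst_and_snd hu0] with z hz
    have := abs_test_sub_le hp hδ (hη1 z.1) (hη1 z.2)
      (by linarith [hz.1] : δ ≤ u z.1 + δ) (by linarith [hz.2] : δ ≤ u z.2 + δ)
    simpa [piconeTest] using this

/-! ### The Picone defect and its uniform integral bound. -/

/-- The nonnegative defect in the discrete Picone inequality, divided by the Gagliardo kernel. -/
noncomputable def piconeDefect (N : ℕ) (s p δ : ℝ) (η u : Euc N → ℝ) (z : Euc N × Euc N) : ℝ :=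
  |η z.1 - η z.2| ^ p / ‖z.1 - z.2‖ ^ ((N : ℝ) + s * p) -
    Jp p (u z.1 - u z.2) * (piconeTest p δ η u z.1 - piconeTest p δ η u z.2) /
      ‖z.1 - z.2‖ ^ ((N : ℝ) + s * p)

theorem piconeDefect_nonneg {N : ℕ} {s p δ : ℝ} (hp : 1 < p) (hδ : 0 < δ) {η u : Euc N → ℝ}
    (hη : ∀ x, 0 ≤ η x) {z : Euc N × Euc N} (h1 : 0 ≤ u z.1) (h2 : 0 ≤ u z.2) :
    0 ≤ piconeDefect N s p δ η u z := by
  have := discrete_picone hp (by linarith : 0 < u z.1 + δ) (by linarith : 0 < u z.2 + δ)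
    (hη z.1) (hη z.2)
  rw [add_sub_add_right_eq_sub] at this
  unfold piconeDefect piconeTest
  rw [sub_nonneg]
  gcongr

/-- The Picone defect of a supersolution has integral bounded independently of `δ`. -/
theorem exists_lintegral_piconeDefect_le {N : ℕ} {s p q μ : ℝ} (hs0 : 0 < s) (hp : 1 < p)
    (hsp : s * p < (N : ℝ)) (hpq : p ≤ q) (hq : q ≤ critExp N s p)
    {Ω : Set (Euc N)} (hΩ : MeasurableSet Ω) (hΩv : volume Ω < ⊤) {a u η : Euc N → ℝ}
    (ha : MemLp a (ENNReal.ofReal ((N : ℝ) / (s * p))) (volume.restrict Ω))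
    (hu : IsNonnegWeakSupersolution s p q μ Ω a u) (hη : Measurable η)
    (hη1 : ∀ x, η x ∈ Set.Icc (0 : ℝ) 1) (hη0 : ∀ x, x ∉ Ω → η x = 0)
    (hηg : gagliardoPow N s p η < ⊤) :
    ∃ K : ℝ, ∀ δ : ℝ, 0 < δ →
      AEMeasurable (piconeDefect N s p δ η u) ∧
      ∫⁻ z, ENNReal.ofReal (piconeDefect N s p δ η u z) ≤ ENNReal.ofReal K := by
  have : IsFiniteMeasure (volume.restrict Ω) := isFiniteMeasure_restrict.2 hΩv.ne
  have hum : AEMeasurable u := hu.memD0.memLp.aestronglyMeasurable.aemeasurable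
  -- Since `N / (s p) ≥ 1` and Ω has finite measure, a is in `L^1`; this suffices as `u^(p-1) φ ≤
  -- 1`.
  have hai : Integrable a (volume.restrict Ω) := by
    refine memLp_one_iff_integrable.1 (ha.mono_exponent ?_)
    rw [ENNReal.one_le_ofReal, one_le_div (by positivity)]
    exact hsp.le
  have hP : 0 < critExp N s p := by linarith
  have hui : Integrable (fun x => 1 + u x ^ critExp N s p) (volume.restrict Ω) := by
    have h := (hu.memD0.memLp.restrict Ω).integrable_norm_rpow'
    rw [ENNReal.toReal_ofReal hP.le] at h
    refine (integrable_const 1).add (h.congr (ae_restrict_of_ae ?_))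
    filter_upwards [hu.nonneg] with x hx
    rw [Real.norm_eq_abs, abs_of_nonneg hx]
  have hGi := integrable_gagliardo_quotient hη.aemeasurable hηg
  refine ⟨(∫ z : Euc N × Euc N, |η z.1 - η z.2| ^ p / ‖z.1 - z.2‖ ^ ((N : ℝ) + s * p)) +
    (|μ| * (∫ x in Ω, (1 + u x ^ critExp N s p)) + ∫ x in Ω, |a x|), fun δ hδ => ?_⟩
  have hφ := memD0_piconeTest hp hδ hΩ hΩv hη hη1 hη0 hηg hu.memD0 hu.nonneg
  have hFi := integrable_fracPLap_integrand hp hum (aemeasurable_piconeTest hη hum)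
    hu.memD0.gagliardo_lt_top hφ.gagliardo_lt_top
  have hDi : Integrable (piconeDefect N s p δ η u) := hGi.sub hFi
  refine ⟨hDi.aestronglyMeasurable.aemeasurable, ?_⟩
  have hD0 : 0 ≤ᵐ[volume] piconeDefect N s p δ η u := by
    filter_upwards [ae_fst_and_snd hu.nonneg] with z hz
    exact piconeDefect_nonneg hp hδ (fun x => (hη1 x).1) hz.1 hz.2
  rw [← ofReal_integral_eq_lintegral_ofReal hDi hD0]
  refine ENNReal.ofReal_le_ofReal ?_
  have e : ∫ z, piconeDefect N s p δ η u z =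
      (∫ z : Euc N × Euc N, |η z.1 - η z.2| ^ p / ‖z.1 - z.2‖ ^ ((N : ℝ) + s * p)) -
        fracPLapForm N s p u (piconeTest p δ η u) := integral_sub hGi hFi
  have hφ0 : ∀ᵐ x : Euc N, 0 ≤ piconeTest p δ η u x := by
    filter_upwards [hu.nonneg] with x hx using piconeTest_nonneg hδ (hη1 x).1 hx
  have hineq := hu.ineq _ hφ hφ0
  have b1 : |∫ x in Ω, u x ^ (q - 1) * piconeTest p δ η u x| ≤
      ∫ x in Ω, (1 + u x ^ critExp N s p) := by
    rw [← Real.norm_eq_abs]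
    refine norm_integral_le_of_norm_le hui (ae_restrict_of_ae ?_)
    filter_upwards [hu.nonneg, hφ0] with x hx hx'
    rw [Real.norm_eq_abs, abs_of_nonneg (by positivity)]
    exact rpow_mul_piconeTest_le hp hpq hq hδ (hη1 x) hx
  have b2 : |∫ x in Ω, a x * u x ^ (p - 1) * piconeTest p δ η u x| ≤ ∫ x in Ω, |a x| := by
    rw [← Real.norm_eq_abs]
    refine norm_integral_le_of_norm_le hai.abs (ae_restrict_of_ae ?_)
    filter_upwards [hu.nonneg, hφ0] with x hx hx'
    rw [Real.norm_eq_abs, mul_assoc, abs_mul,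
      abs_of_nonneg (by positivity : 0 ≤ u x ^ (p - 1) * piconeTest p δ η u x)]
    exact mul_le_of_le_one_right (abs_nonneg _)
      (rpow_sub_one_mul_piconeTest_le_one hp hδ (hη1 x) hx)
  have b3 : -(|μ| * ∫ x in Ω, (1 + u x ^ critExp N s p)) ≤
      μ * ∫ x in Ω, u x ^ (q - 1) * piconeTest p δ η u x := by
    have h := neg_abs_le (μ * ∫ x in Ω, u x ^ (q - 1) * piconeTest p δ η u x)
    rw [abs_mul] at h
    have := mul_le_mul_of_nonneg_left b1 (abs_nonneg μ)
    linarith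
  rw [e]
  linarith [(abs_le.1 b2).2]

/-! ### Blow-up of the defect and conclusion. -/

/-- Here `J_p(u(x) - u(y)) = -u(y)^(p-1)` is fixed and negative, while φ(x) is `η(x)^p δ^(1-p)` with
`δ = 1 / (n + 1)` and φ(y) stays bounded. -/
theorem tendsto_piconeDefect {N : ℕ} {s p : ℝ} (hp : 1 < p) {η u : Euc N → ℝ}
    (hη : ∀ x, 0 ≤ η x) {z : Euc N × Euc N} (h1 : u z.1 = 0) (hη1 : 0 < η z.1)
    (h2 : 0 < u z.2) :
    Filter.Tendsto (fun n : ℕ => piconeDefect N s p ((n : ℝ) + 1)⁻¹ η u z)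
      Filter.atTop Filter.atTop := by
  have hne : z.1 ≠ z.2 := fun h => by rw [← h, h1] at h2; exact lt_irrefl _ h2
  have hk : 0 < ‖z.1 - z.2‖ ^ ((N : ℝ) + s * p) :=
    Real.rpow_pos_of_pos (norm_pos_iff.2 (sub_ne_zero.2 hne)) _
  set c : ℝ := u z.2 ^ (p - 1) / ‖z.1 - z.2‖ ^ ((N : ℝ) + s * p) with hc
  have hc0 : 0 < c := by positivity
  have hJ : Jp p (u z.1 - u z.2) = -u z.2 ^ (p - 1) := by
    rw [h1, zero_sub, Jp, abs_neg, abs_of_pos h2, mul_neg, ← Real.rpow_add_one h2.ne']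
    ring_nf
  have hlim : Filter.Tendsto (fun n : ℕ => c * (η z.1 ^ p * ((n : ℝ) + 1) ^ (p - 1)) -
      c * (η z.2 ^ p * u z.2 ^ (1 - p))) Filter.atTop Filter.atTop := by
    refine Filter.tendsto_atTop_add_const_right _ _ ?_
    refine Filter.Tendsto.const_mul_atTop hc0 (Filter.Tendsto.const_mul_atTop (by positivity) ?_)
    exact (tendsto_rpow_atTop (by linarith)).comp
      (Filter.tendsto_atTop_add_const_right _ _ tendsto_natCast_atTop_atTop)
  refine Filter.tendsto_atTop_mono (fun n => ?_) hlim
  have hn : (0 : ℝ) < (n : ℝ) + 1 := by positivity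
  have e1 : piconeTest p ((n : ℝ) + 1)⁻¹ η u z.1 = η z.1 ^ p * ((n : ℝ) + 1) ^ (p - 1) := by
    rw [piconeTest, h1, zero_add, Real.inv_rpow hn.le, ← Real.rpow_neg hn.le, neg_sub]
  have e2 : piconeTest p ((n : ℝ) + 1)⁻¹ η u z.2 ≤ η z.2 ^ p * u z.2 ^ (1 - p) := by
    unfold piconeTest
    refine mul_le_mul_of_nonneg_left ?_ (Real.rpow_nonneg (hη _) _)
    exact Real.rpow_le_rpow_of_nonpos h2 (by linarith [inv_pos.2 hn]) (by linarith)
  have e3 : 0 ≤ |η z.1 - η z.2| ^ p / ‖z.1 - z.2‖ ^ ((N : ℝ) + s * p) := by positivity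
  unfold piconeDefect
  rw [hJ, e1]
  have e4 := mul_le_mul_of_nonneg_left e2 hc0.le
  have e5 : -u z.2 ^ (p - 1) * (η z.1 ^ p * ((n : ℝ) + 1) ^ (p - 1) -
      piconeTest p ((n : ℝ) + 1)⁻¹ η u z.2) / ‖z.1 - z.2‖ ^ ((N : ℝ) + s * p) =
      -(c * (η z.1 ^ p * ((n : ℝ) + 1) ^ (p - 1))) +
        c * piconeTest p ((n : ℝ) + 1)⁻¹ η u z.2 := by
    rw [hc]
    ring
  rw [e5]
  linarith

/-- The interaction between the zero set and the positivity set of a supersolution is null. -/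
theorem ae_not_zero_and_pos {N : ℕ} {s p : ℝ} (hp : 1 < p) {η u : Euc N → ℝ}
    (hη : ∀ x, 0 ≤ η x) {K : ℝ}
    (hK : ∀ δ : ℝ, 0 < δ → AEMeasurable (piconeDefect N s p δ η u) ∧
      ∫⁻ z, ENNReal.ofReal (piconeDefect N s p δ η u z) ≤ ENNReal.ofReal K) :
    ∀ᵐ z : Euc N × Euc N, ¬ ((u z.1 = 0 ∧ 0 < η z.1) ∧ 0 < u z.2) := by
  set f : ℕ → Euc N × Euc N → ENNReal :=
    fun n z => ENNReal.ofReal (piconeDefect N s p ((n : ℝ) + 1)⁻¹ η u z) with hf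
  have hδ : ∀ n : ℕ, (0 : ℝ) < ((n : ℝ) + 1)⁻¹ := fun n => by positivity
  have hfm : ∀ n, AEMeasurable (f n) := fun n => (hK _ (hδ n)).1.ennreal_ofReal
  -- Fatou: the liminf has finite integral, hence is finite almost everywhere.
  have hlt : ∫⁻ z, Filter.liminf (fun n => f n z) Filter.atTop < ⊤ := by
    refine (lintegral_liminf_le' hfm).trans_lt (lt_of_le_of_lt ?_ (ENNReal.ofReal_lt_top (r := K)))
    exact Filter.liminf_le_of_frequently_le'
      (Filter.Eventually.of_forall fun n => (hK _ (hδ n)).2).frequently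
  have hm : AEMeasurable (fun z => Filter.liminf (fun n => f n z) Filter.atTop) := by
    refine ⟨_, Measurable.liminf fun n => (hfm n).measurable_mk, ?_⟩
    filter_upwards [ae_all_iff.2 fun n => (hfm n).ae_eq_mk] with z hz
    simp only [hz]
  filter_upwards [ae_lt_top' hm hlt.ne] with z hz hz'
  have ht : Filter.Tendsto (fun n => f n z) Filter.atTop (nhds ⊤) :=
    ENNReal.tendsto_ofReal_atTop.comp (tendsto_piconeDefect hp hη hz'.1.1 hz'.1.2 hz'.2)
  rw [ht.liminf_eq] at hz
  exact lt_irrefl _ hz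

theorem ae_or_ae_of_ae_prod {N : ℕ} {P Q : Euc N → Prop}
    (h : ∀ᵐ z : Euc N × Euc N, ¬ (P z.1 ∧ Q z.2)) :
    (∀ᵐ x : Euc N, ¬ P x) ∨ ∀ᵐ x : Euc N, ¬ Q x := by
  have h' : volume ({x : Euc N | P x} ×ˢ {x : Euc N | Q x}) = 0 := by
    rw [ae_iff] at h
    simp only [not_not] at h
    exact h
  rw [Measure.volume_eq_prod, Measure.prod_prod, mul_eq_zero] at h'
  simpa only [ae_iff, not_not] using h'

theorem propositionB3 (N : ℕ) (s p q μ : ℝ) (hs0 : 0 < s) (hs1 : s < 1) (hp : 1 < p)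
    (hsp : s * p < (N : ℝ)) (hpq : p ≤ q) (hq : q ≤ critExp N s p)
    (Ω : Set (Euc N)) (hΩo : IsOpen Ω) (hΩb : Bornology.IsBounded Ω) (hΩc : IsConnected Ω)
    (a : Euc N → ℝ)
    (ha : MemLp a (ENNReal.ofReal ((N : ℝ) / (s * p))) (volume.restrict Ω))
    (u : Euc N → ℝ) (hu : IsNonnegWeakSupersolution s p q μ Ω a u)
    (hu0 : ¬ (∀ᵐ x ∂(volume : Measure (Euc N)), u x = 0)) :
    ∀ᵐ x ∂(volume.restrict Ω), 0 < u x := by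
  have hN : 0 < N := by
    have h : (0 : ℝ) < N := lt_trans (by positivity) hsp
    exact_mod_cast h
  have : Nonempty (Fin N) := ⟨⟨0, hN⟩⟩
  -- `Metric.infDist` to the empty set is 0, which would make the cutoff vanish identically.
  have hΩne : Ωᶜ.Nonempty := by
    rw [Set.nonempty_compl]
    rintro rfl
    exact NormedSpace.unbounded_univ ℝ (Euc N) hΩb
  set η : Euc N → ℝ := fun x => min (Metric.infDist x Ωᶜ) 1 with hη
  have hη1 : ∀ x, η x ∈ Set.Icc (0 : ℝ) 1 := fun x =>
    ⟨le_min Metric.infDist_nonneg zero_le_one, min_le_right _ _⟩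
  have hη0 : ∀ x, x ∉ Ω → η x = 0 := by
    intro x hx
    simp [hη, Metric.infDist_zero_of_mem (Set.mem_compl hx)]
  have hηpos : ∀ x ∈ Ω, 0 < η x := by
    intro x hx
    refine lt_min ?_ zero_lt_one
    exact (hΩo.isClosed_compl.notMem_iff_infDist_pos hΩne).1 (fun h => h hx)
  have hηL : LipschitzWith 1 η := (Metric.lipschitz_infDist_pt Ωᶜ).min_const 1
  have hηg : gagliardoPow N s p η < ⊤ := by
    refine gagliardoPow_lt_top_of_lipschitz hs0 hs1 (by linarith) hN hΩo.measurableSet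
      hΩb.measure_lt_top (fun x y => ?_) (fun x y => ?_) hη0
    · simpa [Real.dist_eq, dist_eq_norm] using hηL.dist_le_mul x y
    · have hx := hη1 x
      have hy := hη1 y
      exact abs_le.2 ⟨by linarith [hx.1, hy.2], by linarith [hx.2, hy.1]⟩
  obtain ⟨K, hK⟩ := exists_lintegral_piconeDefect_le hs0 hp hsp hpq hq hΩo.measurableSet
    hΩb.measure_lt_top ha hu hηL.continuous.measurable hη1 hη0 hηg
  rw [ae_restrict_iff' hΩo.measurableSet]
  rcases ae_or_ae_of_ae_prod (P := fun x => u x = 0 ∧ 0 < η x) (Q := fun x => 0 < u x)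
    (ae_not_zero_and_pos hp (fun x => (hη1 x).1) hK) with h | h
  · filter_upwards [h, hu.nonneg] with x hx hx0 hxΩ
    exact lt_of_le_of_ne hx0 fun h0 => hx ⟨h0.symm, hηpos x hxΩ⟩
  · refine absurd ?_ hu0
    filter_upwards [h, hu.nonneg] with x hx hx0
    exact le_antisymm (not_lt.1 hx) hx0
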